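/- **Model.** For finite disjoint sets $W$ (women) and $M$ (men) of the same size, let $\mathcal F(W,M)$ be the set of profiles $\succ_W$ that assign to every woman a total ordering of $M$, and define $\mathcal F(M,W)$ analogously. A perfect marriage is a bijection $\mu:W\to M$; it is stable with respect to $(\succ_W,\succ_M)$ if there is no pair $(w,m)\in W\times M$ such that $w$ and $m$ each prefer the other over their spouse in $\mu$. A stable marriage mechanism is a function $f$ that maps each $(\succ_W,\succ_M)\in\mathcal F(W,M)\times\mathcal F(M,W)$ to a perfect marriage that is stable with respect to $(\succ_W,\succ_M)$. A query algorithm adaptively makes queries, each being an arbitrary Boolean function of $\succ_W$ or an arbitrary Boolean function of $\succ_M$, and then outputs a bit. In a communication protocol, Alice, who holds $\succ_W$, and Bob, who holds $\succ_M$, exchange bits, each bit depending on its sender's input and on the bits exchanged so far, and the output bit is determined by the exchanged bits. Randomized algorithms and protocols are probability distributions over deterministic ones (that is, public coins are allowed); they solve a decision problem with success probability $p$ if on every fixed input the output is correct with probability at least $p$. The cost is the number of queries made (respectively, bits exchanged) in the worst case over inputs and coin outcomes; the randomized query (respectively, communication) complexity of a problem, with success probability $p$, is the lowest cost of a randomized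 query algorithm (respectively, protocol) that solves it with success probability $p$. **Theorem.** Let $\frac12<p\le 1$ (for example $p=\frac23$). There is a constant $c>0$, depending only on $p$, such that the following holds for every $n\ge 2$. Let $W=\{w_1,\dots,w_n\}$ and $M=\{m_1,\dots,m_n\}$ be disjoint sets of size $n$, let $\mu_{\mathrm{id}}$ be the perfect marriage in which $w_i$ is married to $m_i$ for every $i$, and let $f$ be any stable marriage mechanism for $W$ and $M$ (for example the $M$-optimal one). Then the randomized query complexity and the randomized communication complexity, with success probability $p$, of deciding, given $\succ_W\in\mathcal F(W,M)$ and $\succ_M\in\mathcal F(M,W)$, whether $f(\succ_W,\succ_M)=\mu_{\mathrm{id}}$ are both at least $c\,n^2$. In particular, both are $\Omega(n^2)$. -/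

import Mathlib

open scoped ENNReal

namespace StableMarriage

/-! ### Marriage markets with full preference lists -/

/-- A full preference list over `α`: a (strict) total ordering of `α`.
`L.prefers a b` means that `a` precedes `b` on the list, i.e. `a` is preferred over `b`. -/
structure PrefList (α : Type*) where
  prefers : α → α → Prop
  isStrictTotalOrder : IsStrictTotalOrder α prefers

/-- A profile of full preference lists for `A` over `B`. -/
abbrev Profile (A B : Type*) := A → PrefList B

/-- A perfect marriage between `W` and `M`. -/
abbrev Marriage (W M : Type*) := W ≃ M

/-- The pair `(w, m)` is blocking with respect to `μ`: each of `w` and `m` prefers the other over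
their spouse in `μ`. -/
def IsBlockingPair {W M : Type*} (pW : Profile W M) (pM : Profile M W) (μ : Marriage W M)
    (w : W) (m : M) : Prop :=
  (pW w).prefers m (μ w) ∧ (pM m).prefers w (μ.symm m)

/-- A perfect marriage is stable if it has no blocking pair. -/
def IsStable {W M : Type*} (pW : Profile W M) (pM : Profile M W) (μ : Marriage W M) : Prop :=
  ∀ (w : W) (m : M), ¬ IsBlockingPair pW pM μ w m

/-- A stable marriage mechanism maps every pair of profiles to a perfect marriage that is stable
with respect to them. -/
def IsStableMechanism {W M : Type*} (f : Profile W M → Profile M W → Marriage W M) : Prop :=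
  ∀ (pW : Profile W M) (pM : Profile M W), IsStable pW pM (f pW pM)

/-- The marriage in which `w i` is married to `m i` for every `i`, where `w` and `m` enumerate the
women and the men. -/
def idMarriage {n : ℕ} {W M : Type*} (w : Fin n ≃ W) (m : Fin n ≃ M) : Marriage W M :=
  w.symm.trans m

open Classical in
/-- The decision problem: is the output of the mechanism `f` the marriage `μ`? -/
noncomputable def outputIs {W M : Type*} (f : Profile W M → Profile M W → Marriage W M)
    (μ : Marriage W M) (pW : Profile W M) (pM : Profile M W) : Bool :=
  decide (f pW pM = μ)

/-! ### Two-party communication complexity -/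

/-- A deterministic two-party protocol with Boolean output, where Alice holds an element of `X`
and Bob an element of `Y`. At each inner node one of the players sends one bit, which depends on
their own input (and on the node, that is, on the bits exchanged so far). -/
inductive Protocol (X Y : Type*) where
  | output (b : Bool) : Protocol X Y
  | alice (bit : X → Bool) (next : Bool → Protocol X Y) : Protocol X Y
  | bob (bit : Y → Bool) (next : Bool → Protocol X Y) : Protocol X Y

namespace Protocol

/-- The output of the protocol on the input `(x, y)`. -/
def eval {X Y : Type*} (x : X) (y : Y) : Protocol X Y → Bool
  | output b => b
  | alice bit next => (next (bit x)).eval x y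
  | bob bit next => (next (bit y)).eval x y

/-- The number of bits exchanged on the input `(x, y)`. -/
def bits {X Y : Type*} (x : X) (y : Y) : Protocol X Y → ℕ
  | output _ => 0
  | alice bit next => (next (bit x)).bits x y + 1
  | bob bit next => (next (bit y)).bits x y + 1

end Protocol

/-- A randomized (public-coin) protocol: a random choice of a deterministic protocol.
Protocols in which the players toss private coins are a special case: drawing all the private
coins in advance leaves a deterministic protocol. -/
abbrev RandProtocol (X Y : Type*) := PMF (Protocol X Y)

namespace RandProtocol

/-- On every fixed input, the output equals `g x y` with probability at least `p`. -/
def Computes {X Y : Type*} (R : RandProtocol X Y) (p : ℝ) (g : X → Y → Bool) : Prop :=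
  ∀ (x : X) (y : Y), ENNReal.ofReal p ≤ (PMF.map (fun P => P.eval x y) R) (g x y)

/-- The number of bits exchanged in the worst case, over all coin outcomes and all inputs. -/
noncomputable def cost {X Y : Type*} (R : RandProtocol X Y) : ℕ∞ :=
  ⨆ P ∈ R.support, ⨆ (x : X) (y : Y), (P.bits x y : ℕ∞)

end RandProtocol

/-- The randomized communication complexity of `g` with success probability `p`: the lowest cost
of a randomized protocol that computes `g` with success probability at least `p`. -/
noncomputable def randCommComplexity {X Y : Type*} (p : ℝ) (g : X → Y → Bool) : ℕ∞ :=
  ⨅ (R : RandProtocol X Y) (_ : R.Computes p g), R.cost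

/-! ### Query complexity -/

/-- An arbitrary Boolean query to the women's preferences (an element of `X`) or, separately,
to the men's preferences (an element of `Y`). -/
inductive BoolQuery (X Y : Type*) where
  | women (q : X → Bool) : BoolQuery X Y
  | men (q : Y → Bool) : BoolQuery X Y

/-- The answer to a query on the input `(x, y)`. -/
def BoolQuery.answer {X Y : Type*} (x : X) (y : Y) : BoolQuery X Y → Bool
  | women q => q x
  | men q => q y

/-- A deterministic (adaptive) query algorithm with Boolean output: either it stops with an output,
or it makes a query and continues depending on the answer. -/
inductive QueryAlg (X Y : Type*) where
  | output (b : Bool) : QueryAlg X Y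
  | ask (q : BoolQuery X Y) (next : Bool → QueryAlg X Y) : QueryAlg X Y

namespace QueryAlg

/-- The output of the algorithm on the input `(x, y)`. -/
def eval {X Y : Type*} (x : X) (y : Y) : QueryAlg X Y → Bool
  | output b => b
  | ask q next => (next (q.answer x y)).eval x y

/-- The number of queries made on the input `(x, y)`. -/
def queries {X Y : Type*} (x : X) (y : Y) : QueryAlg X Y → ℕ
  | output _ => 0
  | ask q next => (next (q.answer x y)).queries x y + 1

end QueryAlg

/-- A randomized query algorithm: a random choice of a deterministic query algorithm. -/
abbrev RandQueryAlg (X Y : Type*) := PMF (QueryAlg X Y)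

namespace RandQueryAlg

/-- On every fixed input, the output equals `g x y` with probability at least `p`. -/
def Computes {X Y : Type*} (R : RandQueryAlg X Y) (p : ℝ) (g : X → Y → Bool) : Prop :=
  ∀ (x : X) (y : Y), ENNReal.ofReal p ≤ (PMF.map (fun A => A.eval x y) R) (g x y)

/-- The number of queries made in the worst case, over all coin outcomes and all inputs. -/
noncomputable def cost {X Y : Type*} (R : RandQueryAlg X Y) : ℕ∞ :=
  ⨆ A ∈ R.support, ⨆ (x : X) (y : Y), (A.queries x y : ℕ∞)

end RandQueryAlg

/-- The randomized query complexity of `g` with success probability `p`: the lowest worst-case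
number of queries of a randomized query algorithm that computes `g` with success probability at
least `p`. -/
noncomputable def randQueryComplexity {X Y : Type*} (p : ℝ) (g : X → Y → Bool) : ℕ∞ :=
  ⨅ (R : RandQueryAlg X Y) (_ : R.Computes p g), R.cost

end StableMarriage

/-! The problem contains set disjointness on about `n²/4` points. Let `h = n / 2`, and let Alice and
Bob hold sets `x`, `y` of pairs from `Fin h × Fin h`. Woman `i` in the first half ranks the men `h +
j` with `(i, j) ∈ x` above her own partner; man `h + j` does the same with `y`; everybody else ranks
their own partner first. A common pair blocks the identity marriage. If `x` and `y` are disjoint,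
the identity is the only stable marriage, so every stable mechanism must output it
(`outputIs_eq_decide_disjoint`). A query can be simulated by one announced bit, so communication
bounds carry over to queries.

The linear bound for disjointness on `N` points follows Razborov's rectangle argument. Choose `A`
and `i ∈ A`, and then either `x ⊆ A \ {i}` and `y ⊆ Aᶜ` (disjoint pairs), or the same sets with `i`
added to both (pairs meeting only in `i`). For a rectangle that is not exponentially small, `i` is
for most choices a nearly unbiased coordinate on both sides, so the rectangle has comparable weight
on both kinds of pairs (`disjWeight_le`). Otherwise many coordinates are biased, and an
exponential-moment bound makes the family tiny (`card_le_of_biased`).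

A protocol of cost `C` cuts the inputs into at most `2 ^ C` rectangles, which multiplies the
additive error by `2 ^ C`. Weighting pairs by the `t`-th power of the acceptance probability plays
the role of `t` independent runs that must all accept. It beats the constant factor 128 for every `p
> 1/2`, leaving `2 ^ (C t)` against an error exponentially small in `N`. -/

namespace StableMarriage

/-! ### Corruption bound for rectangles of set pairs -/

section Corruption

variable {I : Type*} [DecidableEq I]

/-- If in a family of subsets of `A` each of the coordinates in `B ⊆ A` is biased, then the family
is exponentially small in the size of `B`. -/
lemma card_le_of_biased (A B : Finset I) (hBA : B ⊆ A) (F : Finset (Finset I))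
    (hF : ∀ x ∈ F, x ⊆ A) (P : I → Prop) [DecidablePred P]
    (h : ∀ i ∈ B, 8 * (F.filter (fun x => (i ∈ x ↔ P i))).card ≤ F.card) :
    (F.card : ℝ) ≤ 2 ^ A.card * (4 / 5) ^ B.card := by
  -- `d x` counts the coordinates of `B` at which `x` takes the rare value; its mean over `F` is at
  -- most `|B| / 8`. The bound compares two estimates of the sum of `exp (-d x)`.
  set d : Finset I → ℝ := fun x => ∑ i ∈ B, if (i ∈ x ↔ P i) then 1 else 0 with hd
  have hsum : ∑ x ∈ F, d x ≤ F.card * (B.card / 8) := by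
    rw [hd, Finset.sum_comm]
    calc _ ≤ ∑ i ∈ B, (F.card : ℝ) / 8 := by
          refine Finset.sum_le_sum fun i hi => ?_
          rw [Finset.sum_boole, le_div_iff₀ (by norm_num)]
          have := h i hi
          rw [mul_comm]
          exact_mod_cast this
      _ = _ := by rw [Finset.sum_const, nsmul_eq_mul]; ring
  -- Jensen's inequality, through the tangent line of the exponential at `-|B| / 8`.
  have hlow : F.card * Real.exp (-(B.card / 8 : ℝ)) ≤ ∑ x ∈ F, Real.exp (-d x) := by
    calc _ ≤ ∑ x ∈ F, Real.exp (-(B.card / 8 : ℝ)) * (1 - (d x - B.card / 8)) := by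
          rw [← Finset.mul_sum, mul_comm]
          refine mul_le_mul_of_nonneg_left ?_ (Real.exp_pos _).le
          simp only [Finset.sum_sub_distrib, Finset.sum_const, nsmul_eq_mul]
          linarith
      _ ≤ _ := by
          refine Finset.sum_le_sum fun x _ => ?_
          have : Real.exp (-d x) = Real.exp (-(B.card / 8 : ℝ)) * Real.exp (-(d x - B.card / 8)) := by
            rw [← Real.exp_add]; congr 1; ring
          rw [this]
          refine mul_le_mul_of_nonneg_left ?_ (Real.exp_pos _).le
          have := Real.add_one_le_exp (-(d x - B.card / 8 : ℝ))
          linarith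
  set e : ℝ := Real.exp (-1) with he
  have hexp : ∀ x : Finset I, Real.exp (-d x) = ∏ i ∈ B, if (i ∈ x ↔ P i) then e else 1 := by
    intro x
    rw [hd, ← Finset.sum_neg_distrib, Real.exp_sum]
    refine Finset.prod_congr rfl fun i _ => ?_
    split_ifs <;> simp [he]
  -- Over all subsets of `A` the sum factorises: a coordinate in `B` contributes `1 + e`, any other
  -- one contributes 2.
  have hup : ∑ x ∈ F, Real.exp (-d x) ≤ 2 ^ A.card * ((1 + e) / 2) ^ B.card := by
    calc _ ≤ ∑ x ∈ A.powerset, Real.exp (-d x) :=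
          Finset.sum_le_sum_of_subset_of_nonneg
            (fun x hx => Finset.mem_powerset.2 (hF x hx)) (fun _ _ _ => (Real.exp_pos _).le)
      _ = ∏ i ∈ A, ((if i ∈ B ∧ P i then e else 1) + (if i ∈ B ∧ ¬ P i then e else 1)) := by
          rw [Finset.prod_add]
          refine Finset.sum_congr rfl fun x hx => ?_
          have hxA := Finset.mem_powerset.1 hx
          have : ∏ i ∈ A, (if i ∈ B ∧ (i ∈ x ↔ P i) then e else 1)
              = ∏ i ∈ B, if (i ∈ x ↔ P i) then e else 1 := by
            rw [← Finset.prod_subset hBA]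
            · exact Finset.prod_congr rfl fun i hi => by simp [hi]
            · intro i _ hi; simp [hi]
          rw [hexp, ← this, ← Finset.prod_sdiff hxA, mul_comm]
          congr 1
          · exact Finset.prod_congr rfl fun i hi => by simp [hi]
          · exact Finset.prod_congr rfl fun i hi => by
              simp [(Finset.mem_sdiff.1 hi).2]
      _ = ∏ i ∈ A, (2 * if i ∈ B then (1 + e) / 2 else 1) := by
          refine Finset.prod_congr rfl fun i _ => ?_
          by_cases hB : i ∈ B <;> by_cases hP : P i <;> simp [hB, hP] <;> ring
      _ = _ := by
          rw [Finset.prod_mul_distrib, Finset.prod_const, ← Finset.prod_subset hBA]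
          · congr 1
            rw [Finset.prod_congr rfl (fun i hi => if_pos hi), Finset.prod_const]
          · intro i _ hi; simp [hi]
  have hκ : (1 + e) / 2 * Real.exp (1 / 8) ≤ 4 / 5 := by
    have h1 : e < 0.368 := by
      have := Real.exp_neg_one_lt_d9
      rw [he]; linarith
    have h2 : Real.exp (1 / 8) ≤ 8 / 7 := by
      have h3 := Real.exp_bound_div_one_sub_of_interval (x := 1 / 8) (by norm_num) (by norm_num)
      have h4 : (1 : ℝ) / (1 - 1 / 8) = 8 / 7 := by norm_num
      linarith
    have : 0 < e := Real.exp_pos _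
    nlinarith [Real.exp_pos (1 / 8)]
  have hfin : (F.card : ℝ) ≤ 2 ^ A.card * ((1 + e) / 2 * Real.exp (1 / 8)) ^ B.card := by
    have h1 : Real.exp (1 / 8) ^ B.card * Real.exp (-(B.card / 8 : ℝ)) = 1 := by
      rw [← Real.exp_nat_mul, ← Real.exp_add]
      simp [div_eq_mul_inv]
    calc (F.card : ℝ) = F.card * Real.exp (-(B.card / 8 : ℝ)) * Real.exp (1 / 8) ^ B.card := by
          rw [mul_assoc, mul_comm (Real.exp _), h1, mul_one]
      _ ≤ 2 ^ A.card * ((1 + e) / 2) ^ B.card * Real.exp (1 / 8) ^ B.card := by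
          exact mul_le_mul_of_nonneg_right (hlow.trans hup) (by positivity)
      _ = _ := by rw [mul_pow, mul_assoc]
  refine hfin.trans ?_
  have : 0 < e := Real.exp_pos _
  gcongr

/-- The members of `S` that are subsets of `A`. -/
def below (S : Finset (Finset I)) (A : Finset I) : Finset (Finset I) := S.filter (· ⊆ A)

/-- The members of `S` that are subsets of `A` and contain `i`. -/
def belowWith (S : Finset (Finset I)) (A : Finset I) (i : I) : Finset (Finset I) :=
  S.filter (fun x => i ∈ x ∧ x ⊆ A)

lemma below_erase (S : Finset (Finset I)) (A : Finset I) (i : I) :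
    below S (A.erase i) = (below S A).filter (fun x => i ∉ x) := by
  ext x
  simp only [below, Finset.mem_filter, Finset.subset_erase, and_assoc]

lemma belowWith_eq (S : Finset (Finset I)) (A : Finset I) (i : I) :
    belowWith S A i = (below S A).filter (fun x => i ∈ x) := by
  ext x
  simp only [below, belowWith, Finset.mem_filter]
  tauto

lemma card_belowWith_add (S : Finset (Finset I)) (A : Finset I) (i : I) :
    (belowWith S A i).card + (below S (A.erase i)).card = (below S A).card := by
  rw [below_erase, belowWith_eq]
  exact Finset.card_filter_add_card_filter_not _

lemma card_below_le (S : Finset (Finset I)) (A : Finset I) :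
    (below S A).card ≤ 2 ^ A.card := by
  rw [← Finset.card_powerset]
  exact Finset.card_le_card fun x hx => Finset.mem_powerset.2 (Finset.mem_filter.1 hx).2

/-- The coordinates in `A` that are biased in the family of members of `S` that lie in `A`. -/
def biased (S : Finset (Finset I)) (A : Finset I) : Finset I :=
  A.filter (fun i => 8 * (belowWith S A i).card ≤ (below S A).card ∨
    8 * (below S (A.erase i)).card ≤ (below S A).card)

lemma card_below_le_biased (S : Finset (Finset I)) (A : Finset I) :
    ((below S A).card : ℝ) ≤ 2 ^ A.card * (4 / 5) ^ (biased S A).card := by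
  refine card_le_of_biased A (biased S A) (Finset.filter_subset _ _) (below S A)
    (fun x hx => (Finset.mem_filter.1 hx).2)
    (fun i => 8 * (belowWith S A i).card ≤ (below S A).card) ?_
  intro i hi
  have hi' := (Finset.mem_filter.1 hi).2
  by_cases h : 8 * (belowWith S A i).card ≤ (below S A).card
  · simp [h, ← belowWith_eq]
  · simpa [h, ← below_erase] using hi'.resolve_left h

/-- If at most `|A| / 40` coordinates are biased, each unbiased one contributes at least an eighth
of `|below S A|` to the full sum, and these outweigh the biased ones. If more are biased, `below S
A` is exponentially small, which the second term absorbs. -/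
lemma sum_biased_le (S : Finset (Finset I)) (A : Finset I) :
    ∑ i ∈ biased S A, ((below S (A.erase i)).card : ℝ) ≤
      1 / 4 * ∑ i ∈ A, ((below S (A.erase i)).card : ℝ)
        + A.card * (2 * (199 / 200)) ^ A.card := by
  have one_div_four_pos : (0 : ℝ) < 1 / 4 := by norm_num
  set r : ℝ := ((below S A).card : ℝ) with hr
  have hr0 : 0 ≤ r := by positivity
  have hsub : biased S A ⊆ A := Finset.filter_subset _ _
  have hcard : ((biased S A).card : ℝ) ≤ A.card := by exact_mod_cast Finset.card_le_card hsub
  have hle : ∀ i, ((below S (A.erase i)).card : ℝ) ≤ r := fun i => by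
    have := card_belowWith_add S A i
    rw [hr]; exact_mod_cast (by omega)
  have h1 : ∑ i ∈ biased S A, ((below S (A.erase i)).card : ℝ) ≤ (biased S A).card * r := by
    rw [← nsmul_eq_mul]
    exact Finset.sum_le_card_nsmul _ _ _ fun i _ => hle i
  by_cases hb : 40 * (biased S A).card ≤ A.card
  · have h2 : ((A \ biased S A).card : ℝ) * (r / 8) ≤ ∑ i ∈ A, ((below S (A.erase i)).card : ℝ) := by
      calc _ ≤ ∑ i ∈ A \ biased S A, ((below S (A.erase i)).card : ℝ) := by
            rw [← nsmul_eq_mul]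
            refine Finset.card_nsmul_le_sum _ _ _ fun i hi => ?_
            rw [Finset.mem_sdiff, biased, Finset.mem_filter] at hi
            have h3 : (below S A).card ≤ 8 * (below S (A.erase i)).card := by
              by_contra hcon
              exact hi.2 ⟨hi.1, Or.inr (by omega)⟩
            have : r ≤ 8 * ((below S (A.erase i)).card : ℝ) := by rw [hr]; exact_mod_cast h3
            linarith
        _ ≤ _ := Finset.sum_le_sum_of_subset_of_nonneg Finset.sdiff_subset
            (fun _ _ _ => by positivity)
    have h3 : ((A \ biased S A).card : ℝ) = A.card - (biased S A).card := by
      rw [Finset.cast_card_sdiff hsub]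
    have h4 : 40 * ((biased S A).card : ℝ) ≤ A.card := by exact_mod_cast hb
    have h5 : 0 ≤ (A.card : ℝ) * (2 * (199 / 200)) ^ A.card := by positivity
    refine le_trans ?_ (le_add_of_nonneg_right h5)
    clear h5
    rw [h3] at h2
    have h6 := mul_le_mul_of_nonneg_right h4 hr0
    have h7 : 0 ≤ ((biased S A).card : ℝ) * r := mul_nonneg (Nat.cast_nonneg _) hr0
    linarith
  · have h2 := card_below_le_biased S A
    have h3 : (4 / 5 : ℝ) ^ (biased S A).card ≤ (199 / 200) ^ A.card := by
      have h40 : (4 / 5 : ℝ) ≤ (199 / 200) ^ 40 := by norm_num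
      calc _ ≤ ((199 / 200 : ℝ) ^ 40) ^ (biased S A).card :=
            pow_le_pow_left₀ (by norm_num) h40 _
        _ = (199 / 200 : ℝ) ^ (40 * (biased S A).card) := by rw [pow_mul]
        _ ≤ _ := pow_le_pow_of_le_one (by norm_num) (by norm_num) (by omega)
    have h4 : r ≤ (2 * (199 / 200)) ^ A.card := by
      rw [mul_pow]
      exact h2.trans (mul_le_mul_of_nonneg_left h3 (by positivity))
    have h5 : 0 ≤ ∑ i ∈ A, ((below S (A.erase i)).card : ℝ) :=
      Finset.sum_nonneg fun _ _ => Nat.cast_nonneg _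
    have h6 := mul_le_mul hcard h4 hr0 (Nat.cast_nonneg A.card)
    exact (h1.trans h6).trans (le_add_of_nonneg_left (mul_nonneg one_div_four_pos.le h5))

variable [Fintype I]

/-- The weight of the rectangle `S × T` in the distribution on disjoint pairs of sets: the number
of ways to choose a set `A`, an element `i` of `A`, and disjoint sets `x ∈ S`, `y ∈ T` with
`x ⊆ A \ {i}` and `y ⊆ Aᶜ`. -/
def disjWeight (S T : Finset (Finset I)) : ℕ :=
  ∑ A : Finset I, ∑ i ∈ A, (below S (A.erase i)).card * (below T Aᶜ).card

/-- The weight of the rectangle `S × T` in the distribution on pairs of sets that intersect in one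
element. -/
def interWeight (S T : Finset (Finset I)) : ℕ :=
  ∑ A : Finset I, ∑ i ∈ A, (belowWith S A i).card * (belowWith T (insert i Aᶜ) i).card

/-- The map `(A, i) ↦ (insert i Aᶜ, i)` is an involution on pairs with `i ∈ A`. It exchanges the
roles of the two players. -/
lemma sum_sum_mem_eq_sum_insert_compl {β : Type*} [AddCommMonoid β] (g : Finset I → I → β) :
    ∑ A : Finset I, ∑ i ∈ A, g A i = ∑ A : Finset I, ∑ i ∈ A, g (insert i Aᶜ) i := by
  rw [Finset.sum_sigma', Finset.sum_sigma']
  refine Finset.sum_nbij' (fun a => ⟨insert a.2 a.1ᶜ, a.2⟩) (fun a => ⟨insert a.2 a.1ᶜ, a.2⟩)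
    ?_ ?_ ?_ ?_ ?_
  · intro a _; simp
  · intro a _; simp
  · rintro ⟨A, i⟩ h
    have hi : i ∈ A := by simpa using h
    simp [Finset.insert_erase hi]
  · rintro ⟨A, i⟩ h
    have hi : i ∈ A := by simpa using h
    simp [Finset.insert_erase hi]
  · rintro ⟨A, i⟩ h
    have hi : i ∈ A := by simpa using h
    simp [Finset.insert_erase hi]

lemma disjWeight_comm (S T : Finset (Finset I)) : disjWeight S T = disjWeight T S := by
  rw [disjWeight, sum_sum_mem_eq_sum_insert_compl, disjWeight]
  refine Finset.sum_congr rfl fun A _ => Finset.sum_congr rfl fun i hi => ?_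
  rw [mul_comm]
  congr 3
  · ext j
    by_cases hj : j = i <;> simp [hj]
  · ext j
    by_cases hj : j = i <;> simp [hj, hi]

lemma sum_biased_mul_le (S T : Finset (Finset I)) :
    ∑ A : Finset I, ∑ i ∈ biased S A,
        ((below S (A.erase i)).card : ℝ) * (below T Aᶜ).card ≤
      1 / 4 * disjWeight S T +
        Fintype.card I * (2 ^ Fintype.card I * (1 + 199 / 200) ^ Fintype.card I) := by
  have hpow : ∑ A : Finset I, (199 / 200 : ℝ) ^ A.card = (1 + 199 / 200) ^ Fintype.card I := by
    have := Finset.sum_pow_mul_eq_add_pow (199 / 200 : ℝ) 1 (Finset.univ : Finset I)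
    simpa [add_comm] using this
  calc _ = ∑ A : Finset I, (∑ i ∈ biased S A, ((below S (A.erase i)).card : ℝ)) *
            (below T Aᶜ).card := by simp only [Finset.sum_mul]
    _ ≤ ∑ A : Finset I, (1 / 4 * (∑ i ∈ A, ((below S (A.erase i)).card : ℝ) * (below T Aᶜ).card)
          + Fintype.card I * (2 ^ Fintype.card I * (199 / 200) ^ A.card)) := by
        refine Finset.sum_le_sum fun A _ => ?_
        refine (mul_le_mul_of_nonneg_right (sum_biased_le S A) (by positivity)).trans ?_
        rw [add_mul, mul_assoc (1 / 4 : ℝ), Finset.sum_mul, mul_assoc (A.card : ℝ)]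
        refine add_le_add le_rfl ?_
        have h1 : ((below T Aᶜ).card : ℝ) ≤ 2 ^ Aᶜ.card := by exact_mod_cast card_below_le T Aᶜ
        have h2 : (A.card : ℝ) ≤ Fintype.card I := by exact_mod_cast Finset.card_le_univ A
        have h3 : (2 : ℝ) ^ A.card * 2 ^ Aᶜ.card = 2 ^ Fintype.card I := by
          rw [← pow_add, Finset.card_add_card_compl]
        rw [← h3]
        calc _ ≤ (Fintype.card I : ℝ) * ((2 * (199 / 200)) ^ A.card * 2 ^ Aᶜ.card) := by gcongr
          _ = _ := by rw [mul_pow]; ring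
    _ = _ := by
        rw [Finset.sum_add_distrib, ← Finset.mul_sum, ← Finset.mul_sum, ← Finset.mul_sum, hpow,
          disjWeight]
        push_cast
        rfl

/-- Rectangles of non-negligible weight contain intersecting pairs. -/
theorem disjWeight_le (S T : Finset (Finset I)) :
    (disjWeight S T : ℝ) ≤ 128 * interWeight S T +
      4 * (Fintype.card I * (2 ^ Fintype.card I * (1 + 199 / 200) ^ Fintype.card I)) := by
  have hS := sum_biased_mul_le S T
  have hT := sum_biased_mul_le T S
  rw [← disjWeight_comm] at hT
  set ε : ℝ := Fintype.card I * (2 ^ Fintype.card I * (1 + 199 / 200) ^ Fintype.card I)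
  have hfilter : ∀ (U V : Finset (Finset I)) (A : Finset I),
      ∑ i ∈ biased U A, ((below U (A.erase i)).card : ℝ) * (below V Aᶜ).card =
      ∑ i ∈ A, if i ∈ biased U A then ((below U (A.erase i)).card : ℝ) * (below V Aᶜ).card else 0 := by
    intro U V A
    rw [Finset.sum_ite_mem, Finset.inter_eq_right.2 (show biased U A ⊆ A from Finset.filter_subset _ _)]
  simp only [hfilter] at hS hT
  -- Reindexing aligns the bias estimate for `T` with that for `S` at the same `(A, i)`.
  rw [sum_sum_mem_eq_sum_insert_compl] at hT
  have key : (disjWeight S T : ℝ) ≤ 64 * interWeight S T +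
      (∑ A : Finset I, ∑ i ∈ A, if i ∈ biased S A then
        ((below S (A.erase i)).card : ℝ) * (below T Aᶜ).card else 0) +
      ∑ A : Finset I, ∑ i ∈ A, if i ∈ biased T (insert i Aᶜ) then
        ((below T ((insert i Aᶜ).erase i)).card : ℝ) * (below S (insert i Aᶜ)ᶜ).card else 0 := by
    rw [disjWeight, interWeight]
    push_cast
    rw [Finset.mul_sum, ← Finset.sum_add_distrib, ← Finset.sum_add_distrib]
    refine Finset.sum_le_sum fun A _ => ?_
    rw [Finset.mul_sum, ← Finset.sum_add_distrib, ← Finset.sum_add_distrib]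
    refine Finset.sum_le_sum fun i hi => ?_
    have e1 : (insert i Aᶜ).erase i = Aᶜ := by
      ext j; by_cases hj : j = i <;> simp [hj, hi]
    have e2 : (insert i Aᶜ)ᶜ = A.erase i := by
      ext j; by_cases hj : j = i <;> simp [hj]
    rw [e1, e2]
    set r0 : ℝ := ((below S (A.erase i)).card : ℝ)
    set c0 : ℝ := ((below T Aᶜ).card : ℝ)
    set r1 : ℝ := ((belowWith S A i).card : ℝ)
    set c1 : ℝ := ((belowWith T (insert i Aᶜ) i).card : ℝ)
    have : 0 ≤ r0 := by positivity
    have : 0 ≤ c0 := by positivity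
    have : 0 ≤ r1 := by positivity
    have : 0 ≤ c1 := by positivity
    have p1 : 0 ≤ r1 * c1 := by positivity
    have p2 : 0 ≤ c0 * r0 := by positivity
    -- If `i` is biased on either side, the term is paid for by a bias sum; otherwise each factor
    -- loses at most 8, whence 64.
    by_cases hbS : i ∈ biased S A
    · rw [if_pos hbS]
      split_ifs <;> linarith
    by_cases hbT : i ∈ biased T (insert i Aᶜ)
    · rw [if_pos hbT, if_neg hbS]
      linarith
    rw [if_neg hbS, if_neg hbT, add_zero, add_zero]
    have hgood : ∀ (U : Finset (Finset I)) (E : Finset I), i ∈ E → i ∉ biased U E →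
        ((below U (E.erase i)).card : ℝ) ≤ 8 * (belowWith U E i).card := by
      intro U E hE hb
      rw [biased, Finset.mem_filter, not_and] at hb
      have h1 := hb hE
      have h2 := card_belowWith_add U E i
      push Not at h1
      exact_mod_cast (by omega)
    have g1 : r0 ≤ 8 * r1 := hgood S A hi hbS
    have g2 : c0 ≤ 8 * c1 := by
      have := hgood T _ (Finset.mem_insert_self i Aᶜ) hbT
      rwa [e1] at this
    calc r0 * c0 ≤ (8 * r1) * (8 * c1) := by gcongr
      _ = _ := by ring
  -- Each bias sum is at most a quarter of the disjoint weight plus `ε`; absorbing the two quarters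
  -- doubles 64 to 128 and `2ε` to `4ε`.
  linarith

/-- Erasing `i` from both sets is injective on the intersecting choices and lands in the disjoint
ones. -/
lemma interWeight_univ_le :
    interWeight (Finset.univ : Finset (Finset I)) Finset.univ ≤
      disjWeight (Finset.univ : Finset (Finset I)) Finset.univ := by
  refine Finset.sum_le_sum fun A _ => Finset.sum_le_sum fun i hi => ?_
  have hcard : ∀ (E : Finset I),
      (belowWith (Finset.univ : Finset (Finset I)) E i).card ≤
        (below (Finset.univ : Finset (Finset I)) (E.erase i)).card := by
    intro E
    refine Finset.card_le_card_of_injOn (fun x => x.erase i) ?_ ?_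
    · intro x hx
      simp only [belowWith, below, Finset.coe_filter, Finset.mem_univ, true_and,
        Set.mem_ofPred_eq] at hx ⊢
      exact Finset.erase_subset_erase _ hx.2
    · intro x hx y hy hxy
      simp only [belowWith, Finset.coe_filter, Finset.mem_univ, true_and,
        Set.mem_ofPred_eq] at hx hy
      rw [← Finset.insert_erase hx.1, ← Finset.insert_erase hy.1]
      exact congrArg _ hxy
  have e1 : (insert i Aᶜ).erase i = Aᶜ := by
    ext j; by_cases hj : j = i <;> simp [hj, hi]
  have := hcard (insert i Aᶜ)
  rw [e1] at this
  exact Nat.mul_le_mul (hcard A) this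

lemma four_mul_disjWeight_univ :
    4 * disjWeight (Finset.univ : Finset (Finset I)) Finset.univ =
      Fintype.card I * 4 ^ Fintype.card I := by
  have hb : ∀ E : Finset I, (below (Finset.univ : Finset (Finset I)) E).card = 2 ^ E.card := by
    intro E
    rw [← Finset.card_powerset]
    congr 1
    ext x
    simp [below]
  have h1 : ∀ (A : Finset I), ∀ i ∈ A, 2 * ((below (Finset.univ : Finset (Finset I)) (A.erase i)).card *
      (below (Finset.univ : Finset (Finset I)) Aᶜ).card) = 2 ^ Fintype.card I := by
    intro A i hi
    rw [hb, hb, ← mul_assoc, ← pow_succ', Finset.card_erase_add_one hi, ← pow_add,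
      Finset.card_add_card_compl]
  have h2 : 2 * ∑ A : Finset I, A.card = Fintype.card I * 2 ^ Fintype.card I := by
    have hc : ∑ A : Finset I, A.card = ∑ A : Finset I, Aᶜ.card :=
      (Equiv.sum_comp (Function.Involutive.toPerm _ (compl_involutive (α := Finset I)))
        (fun A => A.card)).symm
    calc 2 * ∑ A : Finset I, A.card = ∑ A : Finset I, (A.card + Aᶜ.card) := by
          rw [Finset.sum_add_distrib, ← hc]; ring
      _ = _ := by simp [Finset.card_add_card_compl, mul_comm]
  calc _ = 2 * ∑ A : Finset I, ∑ i ∈ A, 2 * ((below (Finset.univ : Finset (Finset I)) (A.erase i)).card *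
      (below (Finset.univ : Finset (Finset I)) Aᶜ).card) := by
        simp only [← Finset.mul_sum]; rw [disjWeight]; ring
    _ = 2 * ∑ A : Finset I, A.card * 2 ^ Fintype.card I := by
        congr 1
        refine Finset.sum_congr rfl fun A _ => ?_
        rw [Finset.sum_congr rfl (h1 A), Finset.sum_const, smul_eq_mul]
    _ = _ := by
        rw [← Finset.sum_mul, ← mul_assoc, h2, mul_assoc, ← mul_pow]
        norm_num

end Corruption

end StableMarriage

namespace StableMarriage

/-! ### From rectangles to randomized protocols -/

section RandomizedProtocols

variable {X Y J K : Type*}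

/-- An inequality between the weights of rectangles extends, with a loss of `2 ^ C`, to the weights
of the sets of inputs that a protocol of cost `C` accepts. -/
lemma Protocol.sum_accept_le (φ : J → X) (ψ : K → Y) (u v : J → K → ℝ≥0∞) (ε : ℝ≥0∞)
    (h : ∀ (S : Finset J) (T : Finset K),
      ∑ x ∈ S, ∑ y ∈ T, u x y ≤ ∑ x ∈ S, ∑ y ∈ T, v x y + ε)
    (P : Protocol X Y) : ∀ (C : ℕ) (S : Finset J) (T : Finset K),
      (∀ x ∈ S, ∀ y ∈ T, P.bits (φ x) (ψ y) ≤ C) →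
      ∑ x ∈ S, ∑ y ∈ T, (if P.eval (φ x) (ψ y) = true then u x y else 0) ≤
        ∑ x ∈ S, ∑ y ∈ T, (if P.eval (φ x) (ψ y) = true then v x y else 0) + 2 ^ C * ε := by
  classical
  induction P with
  | output b =>
    intro C S T _
    cases b
    · simp [Protocol.eval]
    · simp only [Protocol.eval, if_true]
      refine (h S T).trans (add_le_add le_rfl ?_)
      exact le_mul_of_one_le_left (by simp) (one_le_pow₀ (by norm_num))
  | alice bit next ih =>
    intro C S T hC
    cases C with
    | zero =>
      -- An inner node always costs a bit, so with budget 0 there are no pairs in `S × T`.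
      have : ∀ x ∈ S, ∑ y ∈ T,
          (if (Protocol.alice bit next).eval (φ x) (ψ y) = true then u x y else 0) = 0 :=
        fun x hx => Finset.sum_eq_zero fun y hy => absurd (hC x hx y hy) (by simp [Protocol.bits])
      rw [Finset.sum_eq_zero this]
      exact zero_le
    | succ C =>
      have hsplit : ∀ w : J → K → ℝ≥0∞,
          ∑ x ∈ S, ∑ y ∈ T,
            (if (Protocol.alice bit next).eval (φ x) (ψ y) = true then w x y else 0) =
          ∑ x ∈ S.filter (fun x => bit (φ x) = true), ∑ y ∈ T,
            (if (next true).eval (φ x) (ψ y) = true then w x y else 0) +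
          ∑ x ∈ S.filter (fun x => ¬ bit (φ x) = true), ∑ y ∈ T,
            (if (next false).eval (φ x) (ψ y) = true then w x y else 0) := by
        intro w
        rw [← Finset.sum_filter_add_sum_filter_not S (fun x => bit (φ x) = true)]
        congr 1
        · exact Finset.sum_congr rfl fun x hx => by
            simp only [Protocol.eval, (Finset.mem_filter.1 hx).2]
        · exact Finset.sum_congr rfl fun x hx => by
            simp only [Protocol.eval, Bool.eq_false_of_not_eq_true (Finset.mem_filter.1 hx).2]
      have h1 := ih true C (S.filter (fun x => bit (φ x) = true)) T fun x hx y hy => by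
        have h2 := hC x (Finset.mem_filter.1 hx).1 y hy
        simp only [Protocol.bits, (Finset.mem_filter.1 hx).2] at h2
        omega
      have h2 := ih false C (S.filter (fun x => ¬ bit (φ x) = true)) T fun x hx y hy => by
        have h2 := hC x (Finset.mem_filter.1 hx).1 y hy
        simp only [Protocol.bits,
          Bool.eq_false_of_not_eq_true (Finset.mem_filter.1 hx).2] at h2
        omega
      rw [hsplit, hsplit]
      refine (add_le_add h1 h2).trans (le_of_eq ?_)
      ring
  | bob bit next ih =>
    intro C S T hC
    cases C with
    | zero =>
      have : ∀ x ∈ S, ∑ y ∈ T,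
          (if (Protocol.bob bit next).eval (φ x) (ψ y) = true then u x y else 0) = 0 :=
        fun x hx => Finset.sum_eq_zero fun y hy => absurd (hC x hx y hy) (by simp [Protocol.bits])
      rw [Finset.sum_eq_zero this]
      exact zero_le
    | succ C =>
      have hsplit : ∀ w : J → K → ℝ≥0∞,
          ∑ x ∈ S, ∑ y ∈ T,
            (if (Protocol.bob bit next).eval (φ x) (ψ y) = true then w x y else 0) =
          ∑ x ∈ S, ∑ y ∈ T.filter (fun y => bit (ψ y) = true),
            (if (next true).eval (φ x) (ψ y) = true then w x y else 0) +
          ∑ x ∈ S, ∑ y ∈ T.filter (fun y => ¬ bit (ψ y) = true),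
            (if (next false).eval (φ x) (ψ y) = true then w x y else 0) := by
        intro w
        rw [← Finset.sum_add_distrib]
        refine Finset.sum_congr rfl fun x _ => ?_
        rw [← Finset.sum_filter_add_sum_filter_not T (fun y => bit (ψ y) = true)]
        congr 1
        · exact Finset.sum_congr rfl fun y hy => by
            simp only [Protocol.eval, (Finset.mem_filter.1 hy).2]
        · exact Finset.sum_congr rfl fun y hy => by
            simp only [Protocol.eval, Bool.eq_false_of_not_eq_true (Finset.mem_filter.1 hy).2]
      have h1 := ih true C S (T.filter (fun y => bit (ψ y) = true)) fun x hx y hy => by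
        have h2 := hC x hx y (Finset.mem_filter.1 hy).1
        simp only [Protocol.bits, (Finset.mem_filter.1 hy).2] at h2
        omega
      have h2 := ih false C S (T.filter (fun y => ¬ bit (ψ y) = true)) fun x hx y hy => by
        have h2 := hC x hx y (Finset.mem_filter.1 hy).1
        simp only [Protocol.bits,
          Bool.eq_false_of_not_eq_true (Finset.mem_filter.1 hy).2] at h2
        omega
      rw [hsplit, hsplit]
      refine (add_le_add h1 h2).trans (le_of_eq ?_)
      ring

/-- The probability that the randomized protocol `R` outputs `true` on the input `(x, y)`. -/
noncomputable def RandProtocol.acceptProb (R : RandProtocol X Y) (x : X) (y : Y) : ℝ≥0∞ :=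
  PMF.map (fun P => P.eval x y) R true

lemma RandProtocol.sum_mul_acceptProb (R : RandProtocol X Y) (φ : J → X) (ψ : K → Y)
    (S : Finset J) (T : Finset K) (u : J → K → ℝ≥0∞) :
    ∑ x ∈ S, ∑ y ∈ T, u x y * R.acceptProb (φ x) (ψ y) =
      ∑' P, R P * ∑ x ∈ S, ∑ y ∈ T, (if P.eval (φ x) (ψ y) = true then u x y else 0) := by
  simp only [acceptProb, PMF.map_apply, Finset.mul_sum, ← ENNReal.tsum_mul_left]
  rw [Summable.tsum_finsetSum fun _ _ => ENNReal.summable]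
  refine Finset.sum_congr rfl fun x _ => ?_
  rw [Summable.tsum_finsetSum fun _ _ => ENNReal.summable]
  refine Finset.sum_congr rfl fun y _ => tsum_congr fun P => ?_
  by_cases hP : P.eval (φ x) (ψ y) = true
  · simp [hP, mul_comm]
  · simp [hP]

lemma RandProtocol.bits_le_of_cost_le {R : RandProtocol X Y} {C : ℕ} (hC : R.cost ≤ C)
    {P : Protocol X Y} (hP : P ∈ R.support) (x : X) (y : Y) : P.bits x y ≤ C := by
  have : (P.bits x y : ℕ∞) ≤ C := by
    refine le_trans ?_ hC
    exact le_iSup₂_of_le P hP (le_iSup₂_of_le x y le_rfl)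
  exact_mod_cast this

/-- An inequality between the weights of rectangles extends to the weights of powers of the
acceptance probability of a randomized protocol. -/
lemma RandProtocol.sum_acceptProb_pow_le (R : RandProtocol X Y) {C : ℕ} (hC : R.cost ≤ C)
    (φ : J → X) (ψ : K → Y) (u v : J → K → ℝ≥0∞) (ε : ℝ≥0∞)
    (h : ∀ (S : Finset J) (T : Finset K),
      ∑ x ∈ S, ∑ y ∈ T, u x y ≤ ∑ x ∈ S, ∑ y ∈ T, v x y + ε) (k : ℕ) :
    ∀ (S : Finset J) (T : Finset K),
      ∑ x ∈ S, ∑ y ∈ T, u x y * R.acceptProb (φ x) (ψ y) ^ k ≤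
        ∑ x ∈ S, ∑ y ∈ T, v x y * R.acceptProb (φ x) (ψ y) ^ k + (2 ^ C) ^ k * ε := by
  induction k with
  | zero => simpa using h
  | succ k ih =>
    intro S T
    simp only [pow_succ (R.acceptProb _ _), ← mul_assoc]
    rw [R.sum_mul_acceptProb φ ψ S T (fun x y => u x y * R.acceptProb (φ x) (ψ y) ^ k),
      R.sum_mul_acceptProb φ ψ S T (fun x y => v x y * R.acceptProb (φ x) (ψ y) ^ k)]
    -- The induction hypothesis is itself a rectangle inequality, for the weights times the `k`-th
    -- power, so the deterministic bound applies to it; averaging over `P` adds one more factor of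
    -- the acceptance probability.
    calc _ ≤ ∑' P, (R P * ∑ x ∈ S, ∑ y ∈ T, (if P.eval (φ x) (ψ y) = true then
                v x y * R.acceptProb (φ x) (ψ y) ^ k else 0) +
              R P * (2 ^ C * ((2 ^ C) ^ k * ε))) := by
          refine ENNReal.tsum_le_tsum fun P => ?_
          by_cases hP : P ∈ R.support
          · rw [← mul_add]
            exact mul_le_mul_right (P.sum_accept_le φ ψ _ _ _ ih C S T
              fun x _ y _ => R.bits_le_of_cost_le hC hP (φ x) (ψ y)) _
          · rw [PMF.mem_support_iff, not_not] at hP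
            simp [hP]
      _ = _ := by
          rw [ENNReal.tsum_add, ENNReal.tsum_mul_right, PMF.tsum_coe, one_mul, pow_succ' (2 ^ C),
            mul_assoc]

lemma RandProtocol.le_acceptProb {R : RandProtocol X Y} {p : ℝ} {g : X → Y → Bool}
    (hR : R.Computes p g) {x : X} {y : Y} (h : g x y = true) :
    ENNReal.ofReal p ≤ R.acceptProb x y := by
  have := hR x y
  rwa [h] at this

lemma RandProtocol.acceptProb_le {R : RandProtocol X Y} {p : ℝ} {g : X → Y → Bool} (hp : 0 ≤ p)
    (hR : R.Computes p g) {x : X} {y : Y} (h : g x y = false) :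
    R.acceptProb x y ≤ ENNReal.ofReal (1 - p) := by
  have h1 := hR x y
  rw [h] at h1
  have h2 := PMF.tsum_coe (PMF.map (fun P => P.eval x y) R)
  rw [tsum_bool] at h2
  rw [ENNReal.ofReal_sub _ hp, ENNReal.ofReal_one]
  refine ENNReal.le_sub_of_add_le_left ENNReal.ofReal_ne_top ?_
  exact (add_le_add h1 le_rfl).trans h2.le

lemma Protocol.eval_eq_of_bits_eq_zero {P : Protocol X Y} {x : X} {y : Y} (h : P.bits x y = 0)
    (x' : X) (y' : Y) : P.eval x' y' = P.eval x y := by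
  cases P with
  | output b => rfl
  | alice bit next => simp [Protocol.bits] at h
  | bob bit next => simp [Protocol.bits] at h

/-- Without communication the acceptance probability does not depend on the input, so a nonconstant
function cannot be computed with an advantage. This later allows additive constants to be absorbed
into `C`. -/
lemma RandProtocol.cost_pos {R : RandProtocol X Y} {p : ℝ} {g : X → Y → Bool} (hp : 1 / 2 < p)
    (hR : R.Computes p g) {x x' : X} {y y' : Y} (h : g x y = true) (h' : g x' y' = false) {C : ℕ}
    (hC : R.cost ≤ C) : 1 ≤ C := by
  by_contra hlt
  obtain rfl : C = 0 := by omega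
  have h1 := le_acceptProb hR h
  have h2 := acceptProb_le (by linarith) hR h'
  have h3 : R.acceptProb x y = R.acceptProb x' y' := by
    rw [acceptProb, acceptProb, PMF.map_apply, PMF.map_apply]
    refine tsum_congr fun P => ?_
    by_cases hP : P ∈ R.support
    · rw [Protocol.eval_eq_of_bits_eq_zero (Nat.le_zero.1 (bits_le_of_cost_le hC hP x y)) x' y']
    · rw [PMF.mem_support_iff, not_not] at hP
      simp [hP]
  rw [h3] at h1
  rcases le_or_gt 0 (1 - p) with h4 | h4
  · have := (ENNReal.ofReal_le_ofReal_iff h4).1 (h1.trans h2)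
    linarith
  -- Here `p > 1`, and `ENNReal.ofReal (1 - p)` truncates to 0.
  · have := h1.trans h2
    rw [ENNReal.ofReal_of_nonpos h4.le, nonpos_iff_eq_zero, ENNReal.ofReal_eq_zero] at this
    linarith

end RandomizedProtocols

/-! ### Communication lower bound for set disjointness -/

section Disjointness

variable {I : Type*} [DecidableEq I] [Fintype I]

/-- The weight of the pair `(x, y)` in the distribution on disjoint pairs of sets. -/
def disjPairWeight (x y : Finset I) : ℕ :=
  ∑ A : Finset I, ∑ i ∈ A, if x ⊆ A.erase i ∧ y ⊆ Aᶜ then 1 else 0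

/-- The weight of the pair `(x, y)` in the distribution on pairs of sets that intersect in one
element. -/
def interPairWeight (x y : Finset I) : ℕ :=
  ∑ A : Finset I, ∑ i ∈ A, if (i ∈ x ∧ x ⊆ A) ∧ (i ∈ y ∧ y ⊆ insert i Aᶜ) then 1 else 0

lemma card_filter_mul_card_filter {α β : Type*} (S : Finset α) (T : Finset β) (P : α → Prop)
    (Q : β → Prop) [DecidablePred P] [DecidablePred Q] :
    (S.filter P).card * (T.filter Q).card = ∑ x ∈ S, ∑ y ∈ T, if P x ∧ Q y then 1 else 0 := by
  rw [Finset.card_filter, Finset.card_filter, Finset.sum_mul_sum]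
  refine Finset.sum_congr rfl fun x _ => Finset.sum_congr rfl fun y _ => ?_
  by_cases hP : P x <;> simp [hP]

lemma sum_mem_sum_comm {I α β : Type*} [Fintype I] (S : Finset α) (T : Finset β)
    (f : Finset I → I → α → β → ℕ) :
    ∑ A : Finset I, ∑ i ∈ A, ∑ x ∈ S, ∑ y ∈ T, f A i x y =
      ∑ x ∈ S, ∑ y ∈ T, ∑ A : Finset I, ∑ i ∈ A, f A i x y := by
  have h : ∀ A : Finset I, ∑ i ∈ A, ∑ x ∈ S, ∑ y ∈ T, f A i x y =
      ∑ x ∈ S, ∑ y ∈ T, ∑ i ∈ A, f A i x y := fun A => by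
    rw [Finset.sum_comm]
    exact Finset.sum_congr rfl fun x _ => Finset.sum_comm
  rw [Finset.sum_congr rfl fun A _ => h A, Finset.sum_comm]
  exact Finset.sum_congr rfl fun x _ => Finset.sum_comm

lemma disjWeight_eq_sum (S T : Finset (Finset I)) :
    disjWeight S T = ∑ x ∈ S, ∑ y ∈ T, disjPairWeight x y := by
  simp only [disjWeight, disjPairWeight, below, card_filter_mul_card_filter, sum_mem_sum_comm]

lemma interWeight_eq_sum (S T : Finset (Finset I)) :
    interWeight S T = ∑ x ∈ S, ∑ y ∈ T, interPairWeight x y := by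
  simp only [interWeight, interPairWeight, belowWith, card_filter_mul_card_filter,
    sum_mem_sum_comm]

lemma disjoint_of_disjPairWeight_ne_zero {x y : Finset I} (h : disjPairWeight x y ≠ 0) :
    Disjoint x y := by
  obtain ⟨A, _, hA⟩ := Finset.exists_ne_zero_of_sum_ne_zero h
  obtain ⟨i, _, hi⟩ := Finset.exists_ne_zero_of_sum_ne_zero hA
  have h' : x ⊆ A.erase i ∧ y ⊆ Aᶜ := by
    by_contra hcon
    exact hi (if_neg hcon)
  exact Finset.disjoint_of_subset_left (h'.1.trans (Finset.erase_subset _ _))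
    (Finset.disjoint_of_subset_right h'.2 disjoint_compl_right)

lemma not_disjoint_of_interPairWeight_ne_zero {x y : Finset I} (h : interPairWeight x y ≠ 0) :
    ¬ Disjoint x y := by
  obtain ⟨A, _, hA⟩ := Finset.exists_ne_zero_of_sum_ne_zero h
  obtain ⟨i, _, hi⟩ := Finset.exists_ne_zero_of_sum_ne_zero hA
  have h' : (i ∈ x ∧ x ⊆ A) ∧ (i ∈ y ∧ y ⊆ insert i Aᶜ) := by
    by_contra hcon
    exact hi (if_neg hcon)
  exact Finset.not_disjoint_iff.2 ⟨i, h'.1.1, h'.2.1⟩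

/-- The trade-off between the success probability and the cost of a randomized protocol for set
disjointness. -/
lemma pow_le_of_computes_disjoint [Nonempty I] {X Y : Type*} (φ : Finset I → X) (ψ : Finset I → Y)
    {g : X → Y → Bool} (hg : ∀ x y, g (φ x) (ψ y) = decide (Disjoint x y)) {p : ℝ} (hp : 0 ≤ p)
    (hp1 : p ≤ 1) {R : RandProtocol X Y} (hR : R.Computes p g) {C : ℕ} (hC : R.cost ≤ C) (t : ℕ) :
    p ^ t ≤ 128 * (1 - p) ^ t + (2 ^ C) ^ t * (16 * (399 / 400) ^ Fintype.card I) := by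
  set N := Fintype.card I with hN
  set D := disjWeight (Finset.univ : Finset (Finset I)) Finset.univ with hD
  set ε : ℝ := 4 * (N * (2 ^ N * (1 + 199 / 200) ^ N)) with hε
  have hε0 : 0 ≤ ε := by positivity
  have hrect : ∀ S T : Finset (Finset I),
      ∑ x ∈ S, ∑ y ∈ T, (disjPairWeight x y : ℝ≥0∞) ≤
        ∑ x ∈ S, ∑ y ∈ T, 128 * (interPairWeight x y : ℝ≥0∞) + ENNReal.ofReal ε := by
    intro S T
    have h1 := ENNReal.ofReal_le_ofReal (disjWeight_le S T)
    rw [ENNReal.ofReal_add (by positivity) hε0, ENNReal.ofReal_mul (by norm_num),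
      ENNReal.ofReal_natCast, ENNReal.ofReal_natCast, disjWeight_eq_sum, interWeight_eq_sum] at h1
    push_cast at h1
    simpa [Finset.mul_sum] using h1
  have h1 := R.sum_acceptProb_pow_le hC φ ψ _ _ _ hrect t Finset.univ Finset.univ
  have hlow : ENNReal.ofReal p ^ t * D ≤ ∑ x : Finset I, ∑ y : Finset I,
      (disjPairWeight x y : ℝ≥0∞) * R.acceptProb (φ x) (ψ y) ^ t := by
    rw [hD, disjWeight_eq_sum]
    push_cast
    simp only [Finset.mul_sum]
    refine Finset.sum_le_sum fun x _ => Finset.sum_le_sum fun y _ => ?_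
    rcases eq_or_ne (disjPairWeight x y) 0 with h0 | h0
    · simp [h0]
    · rw [mul_comm]
      have := R.le_acceptProb hR (x := φ x) (y := ψ y)
        (by simpa [hg] using disjoint_of_disjPairWeight_ne_zero h0)
      gcongr
  have hup : ∑ x : Finset I, ∑ y : Finset I,
      128 * (interPairWeight x y : ℝ≥0∞) * R.acceptProb (φ x) (ψ y) ^ t ≤
      128 * (ENNReal.ofReal (1 - p) ^ t * D) := by
    calc _ ≤ 128 * (ENNReal.ofReal (1 - p) ^ t *
          ((interWeight (Finset.univ : Finset (Finset I)) Finset.univ : ℕ) : ℝ≥0∞)) := by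
          rw [interWeight_eq_sum]
          push_cast
          simp only [Finset.mul_sum]
          refine Finset.sum_le_sum fun x _ => Finset.sum_le_sum fun y _ => ?_
          rcases eq_or_ne (interPairWeight x y) 0 with h0 | h0
          · simp [h0]
          · rw [mul_assoc, mul_comm (interPairWeight x y : ℝ≥0∞)]
            have := R.acceptProb_le hp hR (x := φ x) (y := ψ y)
              (by simpa [hg] using not_disjoint_of_interPairWeight_ne_zero h0)
            gcongr
      _ ≤ _ := by
          have : ((interWeight (Finset.univ : Finset (Finset I)) Finset.univ : ℕ) : ℝ≥0∞) ≤ D := by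
            exact_mod_cast interWeight_univ_le
          gcongr
  have h2 := hlow.trans (h1.trans (add_le_add hup le_rfl))
  have h3 := ENNReal.toReal_mono (by finiteness) h2
  rw [ENNReal.toReal_add (by finiteness) (by finiteness)] at h3
  simp only [ENNReal.toReal_mul, ENNReal.toReal_pow, ENNReal.toReal_ofReal hp,
    ENNReal.toReal_ofReal hε0, ENNReal.toReal_ofReal (sub_nonneg.2 hp1), ENNReal.toReal_natCast,
    ENNReal.toReal_ofNat] at h3
  have hD4 : (4 : ℝ) * D = N * 4 ^ N := by exact_mod_cast four_mul_disjWeight_univ (I := I)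
  have hNpos : (0 : ℝ) < N := by exact_mod_cast Fintype.card_pos
  have hDpos : (0 : ℝ) < D := by
    have : (0 : ℝ) < N * 4 ^ N := by positivity
    linarith
  -- The total disjoint weight is `N * 4 ^ N / 4`, so relative to it the error decays like `(1.995 /
  -- 2) ^ N`.
  have hεD : ε = 16 * (399 / 400) ^ N * D := by
    have h4 : (2 : ℝ) ^ N * (1 + 199 / 200) ^ N = (399 / 400) ^ N * 4 ^ N := by
      rw [← mul_pow, ← mul_pow]; norm_num
    rw [hε, h4]
    linear_combination (-4 * (399 / 400 : ℝ) ^ N) * hD4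
  rw [hεD] at h3
  refine le_of_mul_le_mul_right ?_ hDpos
  linarith

/-- The randomized communication complexity of set disjointness is linear. -/
theorem exists_mul_card_le_cost {p : ℝ} (hp : 1 / 2 < p) (hp1 : p ≤ 1) :
    ∃ c : ℝ, 0 < c ∧ ∀ (I : Type) [DecidableEq I] [Fintype I] [Nonempty I] {X Y : Type*}
      (φ : Finset I → X) (ψ : Finset I → Y) (g : X → Y → Bool),
      (∀ x y, g (φ x) (ψ y) = decide (Disjoint x y)) →
      ∀ R : RandProtocol X Y, R.Computes p g → ∀ C : ℕ, R.cost ≤ C →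
        c * Fintype.card I ≤ C := by
  have hp0 : 0 < p := by linarith
  -- With this `t`, the term `128 * (1 - p) ^ t` is at most half of `p ^ t`.
  obtain ⟨t, ht⟩ := exists_pow_lt_of_lt_one (show (0 : ℝ) < 1 / 256 by norm_num)
    (show (1 - p) / p < 1 by rw [div_lt_one hp0]; linarith)
  have ht' : 256 * (1 - p) ^ t ≤ p ^ t := by
    rw [div_pow, div_lt_iff₀ (by positivity)] at ht
    linarith
  have hL : Real.log (399 / 400) < 0 := Real.log_neg (by norm_num) (by norm_num)
  have hK : Real.log (p ^ t / 32) < 0 := by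
    have : p ^ t ≤ 1 := pow_le_one₀ hp0.le hp1
    exact Real.log_neg (by positivity) (by linarith)
  have h2 : 0 < Real.log 2 := Real.log_pos (by norm_num)
  have hden : 0 < t * Real.log 2 - Real.log (p ^ t / 32) := by
    have : 0 ≤ t * Real.log 2 := by positivity
    linarith
  refine ⟨-Real.log (399 / 400) / (t * Real.log 2 - Real.log (p ^ t / 32)),
    div_pos (by linarith) hden, ?_⟩
  intro I _ _ _ X Y φ ψ g hg R hR C hC
  have hC1 : 1 ≤ C := by
    refine R.cost_pos hp hR (x := φ ∅) (y := ψ ∅) (x' := φ Finset.univ) (y' := ψ Finset.univ)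
      ?_ ?_ hC
    · simp [hg]
    · simp [hg, Finset.univ_nonempty.ne_empty]
  have h3 := pow_le_of_computes_disjoint φ ψ hg hp0.le hp1 hR hC t
  have h4 : p ^ t / 32 ≤ (2 ^ C) ^ t * (399 / 400) ^ Fintype.card I := by linarith
  have h5 := Real.log_le_log (by positivity) h4
  rw [Real.log_mul (by positivity) (by positivity), Real.log_pow, Real.log_pow, Real.log_pow] at h5
  have h6 : (1 : ℝ) ≤ C := by exact_mod_cast hC1
  rw [div_mul_eq_mul_div, div_le_iff₀ hden]
  -- As `C ≥ 1`, the positive constant `-log (p ^ t / 32)` is at most `C` times itself.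
  nlinarith

end Disjointness

end StableMarriage

namespace StableMarriage

/-! ### Reduction from disjointness to stable marriage -/

section Reduction

/-- The preference list that orders by `tier` first, and breaks ties by the enumeration `e`. -/
def tierList {α : Type*} {n : ℕ} (e : α ≃ Fin n) (tier : α → ℕ) : PrefList α where
  prefers a b := toLex (tier a, e a) < toLex (tier b, e b)
  isStrictTotalOrder :=
    (RelEmbedding.preimage ⟨fun a => toLex (tier a, e a), fun a b hab => e.injective (by
      simpa using (Prod.ext_iff.1 (toLex.injective hab)).2)⟩ (· < ·)).isStrictTotalOrder

lemma tierList_prefers_of_lt {α : Type*} {n : ℕ} (e : α ≃ Fin n) {tier : α → ℕ} {a b : α}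
    (h : tier a < tier b) : (tierList e tier).prefers a b :=
  Prod.Lex.toLex_lt_toLex.2 (Or.inl h)

open Classical in
/-- The tier of the pair `(i, j)`: pairs in `Q` come first, then the pairs `(i, i)`, then all the
others. -/
noncomputable def pairTier {n : ℕ} (Q : Fin n → Fin n → Prop) (i j : Fin n) : ℕ :=
  if Q i j then 0 else if i = j then 1 else 2

variable {n : ℕ} {W M : Type*} (w : Fin n ≃ W) (m : Fin n ≃ M)

/-- The women's preferences that encode the relation `Q`. -/
noncomputable def womenProfile (Q : Fin n → Fin n → Prop) : Profile W M :=
  fun a => tierList m.symm (fun b => pairTier Q (w.symm a) (m.symm b))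

/-- The men's preferences that encode the relation `Q`. -/
noncomputable def menProfile (Q : Fin n → Fin n → Prop) : Profile M W :=
  fun b => tierList w.symm (fun a => pairTier Q (w.symm a) (m.symm b))

variable {w m}

lemma not_isStable_idMarriage {Q Q' : Fin n → Fin n → Prop} (hQ : ∀ i, ¬ Q i i)
    (hQ' : ∀ i, ¬ Q' i i) {i j : Fin n} (h : Q i j) (h' : Q' i j) :
    ¬ IsStable (womenProfile w m Q) (menProfile w m Q') (idMarriage w m) := by
  intro hst
  refine hst (w i) (m j) ⟨tierList_prefers_of_lt _ ?_, tierList_prefers_of_lt _ ?_⟩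
  · simp [pairTier, idMarriage, h, hQ]
  · simp [pairTier, idMarriage, h', hQ']

/-- High women and low men have their own partner on top. Hence, for the pair `(i, i)` not to block,
a displaced high man must be married along `Q'`, and a displaced low woman along `Q`. The wife of a
displaced high man is low and displaced, so that couple lies in both relations, which is impossible.
Thus high indices are fixed; a displaced low woman would marry a high man, who is already taken. -/
lemma eq_idMarriage_of_isStable {Q Q' : Fin n → Fin n → Prop} {L : Fin n → Prop}
    (hQ : ∀ i j, Q i j → L i ∧ ¬ L j) (hQ' : ∀ i j, Q' i j → L i ∧ ¬ L j)
    (hdisj : ∀ i j, Q i j → ¬ Q' i j) {μ : Marriage W M}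
    (hμ : IsStable (womenProfile w m Q) (menProfile w m Q') μ) : μ = idMarriage w m := by
  set σ : Fin n ≃ Fin n := (w.trans μ).trans m.symm with hσ
  have hst : ∀ i, ¬ (pairTier Q i i < pairTier Q i (σ i) ∧
      pairTier Q' i i < pairTier Q' (σ.symm i) i) := by
    rintro i ⟨h1, h2⟩
    refine hμ (w i) (m i) ⟨tierList_prefers_of_lt _ ?_, tierList_prefers_of_lt _ ?_⟩
    · simpa [hσ] using h1
    · simpa [hσ] using h2
  have hQd : ∀ i, ¬ Q i i := fun i h => (hQ i i h).2 (hQ i i h).1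
  have hQd' : ∀ i, ¬ Q' i i := fun i h => (hQ' i i h).2 (hQ' i i h).1
  have hhigh : ∀ i, ¬ L i → σ i ≠ i → Q' (σ.symm i) i := by
    intro i hi hne
    by_contra hcon
    have hne' : σ.symm i ≠ i := fun h => hne (by rw [← h, σ.apply_symm_apply, h])
    refine hst i ⟨?_, ?_⟩
    · have : ¬ Q i (σ i) := fun h => hi (hQ _ _ h).1
      simp [pairTier, hQd, this, hne.symm]
    · simp [pairTier, hQd', hcon, hne']
  have hlow : ∀ i, L i → σ i ≠ i → Q i (σ i) := by
    intro i hi hne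
    by_contra hcon
    have hne' : σ.symm i ≠ i := fun h => hne (by rw [← h, σ.apply_symm_apply, h])
    refine hst i ⟨?_, ?_⟩
    · simp [pairTier, hQd, hcon, hne.symm]
    · have : ¬ Q' (σ.symm i) i := fun h => (hQ' _ _ h).2 hi
      simp [pairTier, hQd', this, hne']
  have hfix_high : ∀ i, ¬ L i → σ i = i := by
    intro i hi
    by_contra hne
    have h1 := hhigh i hi hne
    have h2 := (hQ' _ _ h1).1
    have h3 : σ (σ.symm i) ≠ σ.symm i := by
      rw [σ.apply_symm_apply]
      exact fun h => hi (h ▸ h2)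
    have h4 := hlow _ h2 h3
    rw [σ.apply_symm_apply] at h4
    exact hdisj _ _ h4 h1
  have hfix : ∀ i, σ i = i := by
    intro i
    by_contra hne
    have hi : L i := by
      by_contra hi
      exact hne (hfix_high i hi)
    exact hne (σ.injective (hfix_high _ (hQ _ _ (hlow i hi hne)).2))
  ext a
  have := hfix (w.symm a)
  simpa [hσ, idMarriage, m.symm_apply_eq] using this

/-- The relation on `Fin n` that places the set `x` of pairs between the first `h` and the
following `h` elements. -/
def blockRel (n h : ℕ) (x : Finset (Fin h × Fin h)) (i j : Fin n) : Prop :=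
  ∃ k ∈ x, (i : ℕ) = k.1 ∧ (j : ℕ) = h + k.2

lemma blockRel_low {h : ℕ} {x : Finset (Fin h × Fin h)} {i j : Fin n}
    (hx : blockRel n h x i j) : (i : ℕ) < h ∧ ¬ (j : ℕ) < h := by
  obtain ⟨k, _, hi, hj⟩ := hx
  have := k.1.2
  omega

lemma outputIs_eq_decide_disjoint {f : Profile W M → Profile M W → Marriage W M}
    (hf : IsStableMechanism f) {h : ℕ} (hn : h + h ≤ n) (x y : Finset (Fin h × Fin h)) :
    outputIs f (idMarriage w m) (womenProfile w m (blockRel n h x))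
      (menProfile w m (blockRel n h y)) = decide (Disjoint x y) := by
  rw [outputIs]
  refine decide_eq_decide.2 ⟨fun heq => ?_, fun hd => ?_⟩
  · rw [Finset.disjoint_left]
    intro k hkx hky
    have hst := hf (womenProfile w m (blockRel n h x)) (menProfile w m (blockRel n h y))
    rw [heq] at hst
    have hirr : ∀ (z : Finset (Fin h × Fin h)) (i : Fin n), ¬ blockRel n h z i i :=
      fun z i hz => (blockRel_low hz).2 (blockRel_low hz).1
    have h1 := k.1.2
    have h2 := k.2.2
    exact not_isStable_idMarriage (hirr x) (hirr y)
      (i := ⟨k.1, by omega⟩) (j := ⟨h + k.2, by omega⟩)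
      ⟨k, hkx, rfl, rfl⟩ ⟨k, hky, rfl, rfl⟩ hst
  · refine eq_idMarriage_of_isStable (L := fun i => (i : ℕ) < h)
      (fun _ _ => blockRel_low) (fun _ _ => blockRel_low) ?_ (hf _ _)
    rintro i j ⟨k, hk, hi, hj⟩ ⟨k', hk', hi', hj'⟩
    have : k = k' := by
      ext
      · omega
      · omega
    exact Finset.disjoint_left.1 hd hk (this ▸ hk')

end Reduction

/-! ### Queries as communication, and the final bounds -/

section Queries

variable {X Y : Type*}

/-- The protocol in which the player who can answer the next query announces its answer. -/
def QueryAlg.toProtocol : QueryAlg X Y → Protocol X Y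
  | output b => .output b
  | ask (.women q) next => .alice q fun b => (next b).toProtocol
  | ask (.men q) next => .bob q fun b => (next b).toProtocol

lemma QueryAlg.eval_toProtocol (x : X) (y : Y) (A : QueryAlg X Y) :
    A.toProtocol.eval x y = A.eval x y := by
  induction A with
  | output b => rfl
  | ask q next ih =>
    cases q <;> simp [toProtocol, Protocol.eval, eval, BoolQuery.answer, ih]

lemma QueryAlg.bits_toProtocol (x : X) (y : Y) (A : QueryAlg X Y) :
    A.toProtocol.bits x y = A.queries x y := by
  induction A with
  | output b => rfl
  | ask q next ih =>
    cases q <;> simp [toProtocol, Protocol.bits, queries, BoolQuery.answer, ih]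

lemma randCommComplexity_le_randQueryComplexity (p : ℝ) (g : X → Y → Bool) :
    randCommComplexity p g ≤ randQueryComplexity p g := by
  refine le_iInf₂ fun R hR => ?_
  refine (iInf₂_le (R.map QueryAlg.toProtocol) ?_).trans ?_
  · intro x y
    rw [PMF.map_comp]
    simpa [Function.comp_def, QueryAlg.eval_toProtocol] using hR x y
  · refine iSup₂_le fun P hP => iSup₂_le fun x y => ?_
    obtain ⟨A, hA, rfl⟩ := (PMF.mem_support_map_iff _ _ _).1 hP
    rw [QueryAlg.bits_toProtocol]
    exact le_iSup₂_of_le A hA (le_iSup₂_of_le x y le_rfl)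

end Queries

lemma ofReal_le_randCommComplexity {X Y : Type*} {p r : ℝ} {g : X → Y → Bool}
    (h : ∀ R : RandProtocol X Y, R.Computes p g → ∀ C : ℕ, R.cost ≤ C → r ≤ C) :
    ENNReal.ofReal r ≤ (randCommComplexity p g : ℝ≥0∞) := by
  -- The complexity takes values in `ℕ∞`, so the real bound is first rounded up; infinite cost is
  -- trivial.
  have hceil : ((⌈r⌉₊ : ℕ) : ℕ∞) ≤ randCommComplexity p g := by
    refine le_iInf₂ fun R hR => ?_
    cases hc : R.cost with
    | top => exact le_top
    | coe C => exact_mod_cast Nat.ceil_le.2 (h R hR C hc.le)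
  calc ENNReal.ofReal r ≤ ENNReal.ofReal (⌈r⌉₊ : ℝ) := ENNReal.ofReal_le_ofReal (Nat.le_ceil r)
    _ = (((⌈r⌉₊ : ℕ) : ℕ∞) : ℝ≥0∞) := by simp
    _ ≤ _ := ENat.toENNReal_mono hceil

end StableMarriage

theorem mainTheorem8 (p : ℝ) (hp : 1 / 2 < p) (hp1 : p ≤ 1) :
    ∃ c : ℝ, 0 < c ∧
      ∀ (n : ℕ), 2 ≤ n →
      ∀ (W : Type*) (M : Type*) (w : Fin n ≃ W) (m : Fin n ≃ M)
        (f : StableMarriage.Profile W M → StableMarriage.Profile M W →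
          StableMarriage.Marriage W M),
        StableMarriage.IsStableMechanism f →
          ENNReal.ofReal (c * (n : ℝ) ^ 2) ≤
            (StableMarriage.randQueryComplexity p
              (StableMarriage.outputIs f (StableMarriage.idMarriage w m)) : ℝ≥0∞) ∧
          ENNReal.ofReal (c * (n : ℝ) ^ 2) ≤
            (StableMarriage.randCommComplexity p
              (StableMarriage.outputIs f (StableMarriage.idMarriage w m)) : ℝ≥0∞) := by
  obtain ⟨c, hc, hlow⟩ := StableMarriage.exists_mul_card_le_cost hp hp1
  -- For `n ≥ 2`, `n ≤ 3 * (n / 2)` even with the floor (equality at 3), so the `(n / 2) ^ 2` points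
  -- number at least `n ^ 2 / 9`.
  refine ⟨c / 9, by positivity, ?_⟩
  intro n hn W M w m f hf
  have hcomm : ENNReal.ofReal (c / 9 * (n : ℝ) ^ 2) ≤
      (StableMarriage.randCommComplexity p
        (StableMarriage.outputIs f (StableMarriage.idMarriage w m)) : ℝ≥0∞) := by
    refine StableMarriage.ofReal_le_randCommComplexity fun R hR C hC => ?_
    have : Nonempty (Fin (n / 2)) := ⟨⟨0, by omega⟩⟩
    have h1 := hlow (Fin (n / 2) × Fin (n / 2)) _ _ _
      (StableMarriage.outputIs_eq_decide_disjoint hf (by omega)) R hR C hC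
    refine le_trans ?_ h1
    have h2 : (n : ℝ) ≤ 3 * ((n / 2 : ℕ) : ℝ) := by exact_mod_cast (by omega : n ≤ 3 * (n / 2))
    have h3 : (n : ℝ) ^ 2 ≤ (3 * ((n / 2 : ℕ) : ℝ)) ^ 2 := pow_le_pow_left₀ (Nat.cast_nonneg n) h2 2
    rw [Fintype.card_prod, Fintype.card_fin, Nat.cast_mul]
    have h4 := mul_le_mul_of_nonneg_left h3 hc.le
    linarith
  exact ⟨hcomm.trans (ENat.toENNReal_mono
    (StableMarriage.randCommComplexity_le_randQueryComplexity _ _)), hcomm⟩
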